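/- Let $M$ be a smooth manifold without boundary, let $g$ be a smooth Riemannian metric on $M$ and let $J$ be a smooth almost complex structure on $M$ with $g(Jx,Jy)=g(x,y)$ for all tangent vectors $x,y$ at a common point, so that $(M,g,J)$ is an almost Hermitian manifold. Let $\alpha:M\to\mathbb{R}$ be smooth; then $(M,e^{\alpha}g,J)$ is a conformally equivalent almost Hermitian manifold. For a Riemannian metric $h$ on $M$ with Levi-Civita connection $\nabla^h$ let $\mathcal{R}_h(x,y)z=\nabla^h_x\nabla^h_y z-\nabla^h_y\nabla^h_x z-\nabla^h_{[x,y]}z$ be its curvature tensor, viewed as a tensor of type $(1,3)$, and let $\mathcal{J}_h(x)y=\mathcal{R}_h(y,x)x$ be its Jacobi operator. A complex line in $T_PM$ is a real $2$-dimensional subspace $\pi$ with $J\pi=\pi$; if $x\in\pi$ and $g(x,x)=1$, then $\pi=\pi_x:=\operatorname{span}\{x,Jx\}$, and the complex Jacobi operators of $g$ and of $e^{\alpha}g$ along $\pi_x$, both formed with the same vector $x$, are $$\mathcal{J}_g(\pi_x)=\mathcal{J}_g(x)+\mathcal{J}_g(Jx),\qquad \mathcal{J}_{e^{\alpha}g}(\pi_x)=\mathcal{J}_{e^{\alpha}g}(x)+\mathcal{J}_{e^{\alpha}g}(Jx).$$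 If $\mathcal{J}_g(\pi_x)=\mathcal{J}_{e^{\alpha}g}(\pi_x)$ for every $P\in M$, every complex line $\pi\subset T_PM$ and every $x\in\pi$ with $g(x,x)=1$, then $\mathcal{R}_g=\mathcal{R}_{e^{\alpha}g}$ on all of $M$. -/

import Mathlib

open scoped Manifold ContDiff Bundle

noncomputable section

/-! ### Local Riemannian geometry on a vector space

`G : E → E →L[ℝ] E →L[ℝ] ℝ` is the field of metric coefficients `g_{ij}` of a Riemannian metric in
a coordinate chart with values in `E`. -/

namespace LocalMetric

variable {E : Type*} [NormedAddCommGroup E] [NormedSpace ℝ E]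

/-- The Christoffel symbols of the second kind: `christoffel G u v w` is the vector `Γ` with
`G_u(Γ, z) = ½ (∂_v G (w, z) + ∂_w G (v, z) - ∂_z G (v, w))` for all `z`. -/
def christoffel (G : E → E →L[ℝ] E →L[ℝ] ℝ) (u v w : E) : E :=
  (G u).inverse ((2⁻¹ : ℝ) •
    (fderiv ℝ G u v w + fderiv ℝ G u w v - ((fderiv ℝ G u).flip v).flip w))

/-- The Levi-Civita covariant derivative `∇_X Y` of vector fields in the chart. -/
def covDeriv (G : E → E →L[ℝ] E →L[ℝ] ℝ) (X Y : E → E) (u : E) : E :=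
  fderiv ℝ Y u (X u) + christoffel G u (X u) (Y u)

/-- The curvature operator `𝓡(x, y) z = ∇_x ∇_y z - ∇_y ∇_x z - ∇_{[x, y]} z`; the vectors
`x, y, z` are extended to constant (coordinate) vector fields, so that `[x, y] = 0`. -/
def curvature (G : E → E →L[ℝ] E →L[ℝ] ℝ) (u x y z : E) : E :=
  covDeriv G (fun _ => x) (covDeriv G (fun _ => y) (fun _ => z)) u
    - covDeriv G (fun _ => y) (covDeriv G (fun _ => x) (fun _ => z)) u

end LocalMetric

/-! ### Almost Hermitian manifolds -/

/-- An almost Hermitian structure `(g, J)` on the smooth manifold `M` (without boundary, modelled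
on the real vector space `E`): a smooth Riemannian metric `g` and a smooth, `g`-orthogonal almost
complex structure `J` on the tangent bundle. -/
structure AlmostHermitian (E : Type*) [NormedAddCommGroup E] [NormedSpace ℝ E]
    (M : Type*) [TopologicalSpace M] [ChartedSpace E M] [IsManifold 𝓘(ℝ, E) ∞ M] where
  /-- the Riemannian metric -/
  g : Bundle.ContMDiffRiemannianMetric 𝓘(ℝ, E) ∞ E
    (fun P : M => TangentSpace 𝓘(ℝ, E) P)
  /-- the almost complex structure -/
  J : ∀ P : M, TangentSpace 𝓘(ℝ, E) P →L[ℝ] TangentSpace 𝓘(ℝ, E) P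
  smooth_J : ContMDiff 𝓘(ℝ, E) (𝓘(ℝ, E).prod 𝓘(ℝ, E →L[ℝ] E)) ∞
    (fun P : M => Bundle.TotalSpace.mk' (E →L[ℝ] E)
      (E := fun P : M => TangentSpace 𝓘(ℝ, E) P →L[ℝ] TangentSpace 𝓘(ℝ, E) P) P (J P))
  J_sq : ∀ (P : M) (v : TangentSpace 𝓘(ℝ, E) P), J P (J P v) = -v
  unitary : ∀ (P : M) (v w : TangentSpace 𝓘(ℝ, E) P),
    g.inner P (J P v) (J P w) = g.inner P v w

section Geometry

variable {E : Type*} [NormedAddCommGroup E] [NormedSpace ℝ E]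
  {M : Type*} [TopologicalSpace M] [ChartedSpace E M] [IsManifold 𝓘(ℝ, E) ∞ M]

/-- The conformally rescaled Riemannian metric `e^α g`. -/
def conformalMetric
    (g : Bundle.ContMDiffRiemannianMetric 𝓘(ℝ, E) ∞ E (fun P : M => TangentSpace 𝓘(ℝ, E) P))
    (α : M → ℝ) (hα : ContMDiff 𝓘(ℝ, E) 𝓘(ℝ, ℝ) ∞ α) :
    Bundle.ContMDiffRiemannianMetric 𝓘(ℝ, E) ∞ E
      (fun P : M => TangentSpace 𝓘(ℝ, E) P) where
  inner P := Real.exp (α P) • g.inner P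
  symm P v w := by simp [g.symm P v w]
  pos P v hv := by
    simpa using mul_pos (Real.exp_pos (α P)) (g.pos P v hv)
  isVonNBounded P := by
    let c : ℝ := Real.exp (α P / 2)
    have hc : c ≠ 0 := (Real.exp_pos _).ne'
    have hcc : c * c = Real.exp (α P) := by
      rw [← Real.exp_add]; ring_nf
    refine ((g.isVonNBounded P).image
      ((c⁻¹ • ContinuousLinearMap.id ℝ (TangentSpace 𝓘(ℝ, E) P)))).subset ?_
    intro v hv
    refine ⟨c • v, ?_, ?_⟩
    · simp only [Set.mem_ofPred_eq, map_smul, smul_apply, smul_eq_mul] at hv ⊢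
      rwa [← mul_assoc, hcc]
    · simp [smul_smul, hc]
  contMDiff := (Real.contDiff_exp.comp_contMDiff hα).smul_section g.contMDiff

/-- The almost Hermitian manifold `(M, e^α g, J)` conformally equivalent to `(M, g, J)`. -/
def AlmostHermitian.conformal (C : AlmostHermitian E M) (α : M → ℝ)
    (hα : ContMDiff 𝓘(ℝ, E) 𝓘(ℝ, ℝ) ∞ α) : AlmostHermitian E M where
  g := conformalMetric C.g α hα
  J := C.J
  smooth_J := C.smooth_J
  J_sq := C.J_sq
  unitary P v w := by simp [conformalMetric, C.unitary P v w]

/-- The coefficients of the metric `g` in the chart `φ` around `P`: the pull-back of `g` by `φ⁻¹`,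
a field of bilinear forms on the target of `φ`. -/
def metricInChart
    (g : Bundle.ContMDiffRiemannianMetric 𝓘(ℝ, E) ∞ E (fun P : M => TangentSpace 𝓘(ℝ, E) P))
    (P : M) (u : E) : E →L[ℝ] E →L[ℝ] ℝ :=
  let φ := extChartAt 𝓘(ℝ, E) P
  let D : E →L[ℝ] TangentSpace 𝓘(ℝ, E) (φ.symm u) := mfderiv 𝓘(ℝ, E) 𝓘(ℝ, E) φ.symm u
  (ContinuousLinearMap.precomp ℝ D).comp ((g.inner (φ.symm u)).comp D)

/-- The curvature operator `𝓡_P(x, y) z` of the Riemannian metric `g` on `T_P M`: the curvature in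
the chart `φ` around `P`, transported to `T_P M` by the differential of `φ` at `P`. -/
def curvatureOperator
    (g : Bundle.ContMDiffRiemannianMetric 𝓘(ℝ, E) ∞ E (fun P : M => TangentSpace 𝓘(ℝ, E) P))
    (P : M) (x y z : TangentSpace 𝓘(ℝ, E) P) : TangentSpace 𝓘(ℝ, E) P :=
  let φ := extChartAt 𝓘(ℝ, E) P
  let D : TangentSpace 𝓘(ℝ, E) P →L[ℝ] E := mfderiv 𝓘(ℝ, E) 𝓘(ℝ, E) φ P
  D.inverse (LocalMetric.curvature (metricInChart g P) (φ P) (D x) (D y) (D z))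

namespace AlmostHermitian

/-- The Jacobi operator `𝓙(x) : y ↦ 𝓡(y, x) x`. -/
def jacobi (C : AlmostHermitian E M) (P : M) (x y : TangentSpace 𝓘(ℝ, E) P) :
    TangentSpace 𝓘(ℝ, E) P :=
  curvatureOperator C.g P y x x

/-- The operator `𝓙(x) + 𝓙(Jx)`, which for a unit vector `x` is the complex Jacobi operator of the
complex line `span {x, Jx}`. -/
def complexJacobi (C : AlmostHermitian E M) (P : M) (x y : TangentSpace 𝓘(ℝ, E) P) :
    TangentSpace 𝓘(ℝ, E) P :=
  C.jacobi P x y + C.jacobi P (C.J P x) y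

/-- `L` is a complex line in `T_P M`: a real two-dimensional subspace with `J L = L`. -/
def IsComplexLine (C : AlmostHermitian E M) (P : M)
    (L : Submodule ℝ (TangentSpace 𝓘(ℝ, E) P)) : Prop :=
  Module.finrank ℝ L = 2 ∧ L.map (C.J P).toLinearMap = L

end AlmostHermitian

end Geometry

end

set_option maxSynthPendingDepth 3
set_option synthInstance.maxHeartbeats 200000

/-! Put `f = α/2`. The (1,3) curvature tensors of `g` and `e^{2f} g` differ by the Kulkarni–Nomizu
expression of `g` and one self-adjoint endomorphism `s`, built from the Hessian and gradient of `f`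
(`LocalMetric.curvature_conformal`). Both complex Jacobi operators use the same `x` and `J`, so the
hypothesis says that the complex Jacobi operators of this expression vanish, and the rest is linear
algebra at a point (`kulkarniNomizu_eq_zero`).

Evaluating along `x` itself shows that `s` has trace zero on every complex line. In real dimension
at least 4, each `y` is orthogonal to some complex line; evaluating there gives `g(s y, y) = 0`, and
polarization gives `s = 0`. In real dimension 2, `s` may survive, but the tangent space is a single
complex line, and antisymmetry leaves one Jacobi term at a time, which kills the expression. -/

noncomputable section

/-! ### Linear algebra in one tangent space -/

section Algebra

variable {V : Type*} [TopologicalSpace V] [AddCommGroup V] [Module ℝ V]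

/-- The difference of the curvature operators of two conformal metrics, in terms of a self-adjoint
endomorphism `s`: the Kulkarni–Nomizu product of `B` and the form `B (s ·) ·`. -/
def kulkarniNomizu (B : V →L[ℝ] V →L[ℝ] ℝ) (s : V →ₗ[ℝ] V) (x y z : V) : V :=
  B (s x) z • y - B (s y) z • x + B x z • s y - B y z • s x

theorem exists_unit_smul {B : V →L[ℝ] V →L[ℝ] ℝ} (hpos : ∀ v, v ≠ 0 → 0 < B v v) {v : V}
    (hv : v ≠ 0) : ∃ c : ℝ, c ≠ 0 ∧ B (c • v) (c • v) = 1 := by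
  have h := hpos v hv
  refine ⟨(√(B v v))⁻¹, by positivity, ?_⟩
  have h2 : √(B v v) * √(B v v) = B v v := Real.mul_self_sqrt h.le
  have h3 : √(B v v) ≠ 0 := by positivity
  simp only [map_smul, smul_apply, smul_eq_mul]
  field_simp
  nlinarith

variable {B : V →L[ℝ] V →L[ℝ] ℝ} {s : V →ₗ[ℝ] V} {J : V → V}

/-- If the complex Jacobi operators formed from `kulkarniNomizu B s` vanish on all unit vectors,
then so does `kulkarniNomizu B s`. -/
theorem kulkarniNomizu_eq_zero
    (hsymm : ∀ v w, B v w = B w v) (hpos : ∀ v, v ≠ 0 → 0 < B v v)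
    (hs : ∀ v w, B (s v) w = B (s w) v)
    (hJ2 : ∀ v, J (J v) = -v) (hJ : ∀ v w, B (J v) (J w) = B v w)
    (hA : ∀ x, B x x = 1 → ∀ y, kulkarniNomizu B s y x x + kulkarniNomizu B s y (J x) (J x) = 0)
    (x y z : V) : kulkarniNomizu B s x y z = 0 := by
  have hJ1 (v w : V) : B (J v) w = - B v (J w) := by
    have h := hJ v (J w)
    rw [hJ2, map_neg] at h
    linarith
  have hJ0 (v : V) : B v (J v) = 0 := by
    have h := hJ1 v v
    rw [hsymm] at h
    linarith
  have hA' (x : V) (hx : B x x = 1) (y w : V) :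
      B (kulkarniNomizu B s y x x) w + B (kulkarniNomizu B s y (J x) (J x)) w = 0 := by
    have := congrArg (fun v => B v w) (hA x hx y)
    simpa using this
  have htr (x : V) (hx : B x x = 1) : B (s x) x + B (s (J x)) (J x) = 0 := by
    have h := hA' x hx x x
    simp only [kulkarniNomizu, map_sub, map_add, map_smul, sub_apply, add_apply, smul_apply,
      smul_eq_mul, hJ, hx, hJ0, hsymm (J x) x] at h
    linarith
  -- The condition fails exactly in real dimension 2; in dimension 0 it is vacuous.
  by_cases hdim : ∀ y, y ≠ 0 → ∃ x, B x x = 1 ∧ B y x = 0 ∧ B y (J x) = 0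
  -- For `y` orthogonal to the complex line of `x`, pairing with `y` leaves `-2 B(s y, y)` minus
  -- `B(y, y)` times the trace in `htr`.
  · have hzero (y : V) : B (s y) y = 0 := by
      by_cases hy : y = 0
      · simp [hy]
      obtain ⟨x, hx, h1, h2⟩ := hdim y hy
      have h := hA' x hx y y
      simp only [kulkarniNomizu, map_sub, map_add, map_smul, sub_apply, add_apply, smul_apply,
        smul_eq_mul, hJ, hx, h1, h2, hsymm (J x) y, hsymm x y] at h
      have h3 := htr x hx
      linear_combination (-1/2) * h - (B y y) / 2 * h3
    have hform (v w : V) : B (s v) w = 0 := by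
      have h := hzero (v + w)
      simp only [map_add, add_apply, hzero] at h
      have h2 := hs v w
      linarith
    have hsz (v : V) : s v = 0 := by
      by_contra h
      exact (hpos _ h).ne' (hform _ _)
    simp [kulkarniNomizu, hsz]
  · push Not at hdim
    obtain ⟨e', he', hdim⟩ := hdim
    obtain ⟨c, hc, he⟩ := exists_unit_smul hpos he'
    set e := c • e' with hedef
    -- Otherwise the normalized residual of `v` is a unit vector of the kind that `hdim` excludes
    -- for `e'`.
    have hspan (v : V) : v = B v e • e + B v (J e) • J e := by
      by_contra hv
      obtain ⟨d, hd, hw⟩ := exists_unit_smul hpos (sub_ne_zero.2 hv)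
      set w := v - (B v e • e + B v (J e) • J e) with hwdef
      have hwe : B w e = 0 := by
        simp [hwdef, he, hJ0, hsymm (J e) e]
      have hwJe : B w (J e) = 0 := by
        simp [hwdef, he, hJ0, hJ]
      have h1 : B e' w = 0 := by
        have : B w e = c * B w e' := by simp [hedef]
        rw [hsymm]
        simpa [hwe, hc] using this.symm
      refine hdim (d • w) hw (by simp [h1]) ?_
      have h2 : B e (J (d • w)) = 0 := by
        rw [hsymm, hJ1]; simp [hwJe]
      have : B e (J (d • w)) = c * B e' (J (d • w)) := by simp [hedef]
      simpa [h2, hc] using this.symm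
    have hself (v z : V) : kulkarniNomizu B s v v z = 0 := by simp [kulkarniNomizu]
    have h1 : kulkarniNomizu B s e (J e) e = 0 := by
      have h := hA e he (J e)
      rw [hself, add_zero] at h
      rw [← neg_eq_zero, ← h]
      simp only [kulkarniNomizu]
      abel
    have h2 : kulkarniNomizu B s e (J e) (J e) = 0 := by
      have h := hA e he e
      rwa [hself, zero_add] at h
    -- Antisymmetry in the first two slots produces the determinant of `x, y` in the basis `e, J e`.
    have key : kulkarniNomizu B s x y z =
        (B x e * B y (J e) - B x (J e) * B y e) • (B z e • kulkarniNomizu B s e (J e) e +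
          B z (J e) • kulkarniNomizu B s e (J e) (J e)) := by
      have hx := hspan x
      have hy := hspan y
      have hz := hspan z
      generalize B x e = a at *
      generalize B x (J e) = a' at *
      generalize B y e = b at *
      generalize B y (J e) = b' at *
      generalize B z e = c at *
      generalize B z (J e) = c' at *
      generalize J e = f at *
      subst hx hy hz
      simp only [kulkarniNomizu, map_add, map_smul, add_apply, smul_apply, smul_eq_mul]
      module
    rw [key, h1, h2]
    simp

end Algebra

/-! ### Conformal change of connection and curvature in a chart -/

namespace LocalMetric

open Filter Topology

variable {E : Type*} [NormedAddCommGroup E] [NormedSpace ℝ E]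
  {G : E → E →L[ℝ] E →L[ℝ] ℝ} {f : E → ℝ} {u : E}

theorem apply_christoffel (h : (G u).IsInvertible)
    (v w z : E) : G u (christoffel G u v w) z =
      2⁻¹ * (fderiv ℝ G u v w z + fderiv ℝ G u w v z - fderiv ℝ G u z v w) := by
  simp [christoffel, h.self_apply_inverse]

theorem christoffel_add (v w w' : E) :
    christoffel G u v (w + w') = christoffel G u v w + christoffel G u v w' := by
  simp only [christoffel, ← map_add]
  congr 1
  ext z
  simp
  ring

theorem christoffel_smul (c : ℝ) (v w : E) :
    christoffel G u v (c • w) = c • christoffel G u v w := by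
  simp only [christoffel, ← map_smul]
  congr 1
  ext z
  simp
  ring

theorem christoffel_sub (v w w' : E) :
    christoffel G u v (w - w') = christoffel G u v w - christoffel G u v w' := by
  rw [sub_eq_add_neg, ← neg_one_smul ℝ w', christoffel_add, christoffel_smul]
  module

theorem christoffel_comm
    (hsymm : ∀ x v w, fderiv ℝ G u x v w = fderiv ℝ G u x w v) (v w : E) :
    christoffel G u v w = christoffel G u w v := by
  unfold christoffel
  congr 2
  ext z
  simp [hsymm z v w]
  ring

theorem curvature_eq (x y z : E) : curvature G u x y z =
    fderiv ℝ (fun u => christoffel G u y z) u x + christoffel G u x (christoffel G u y z)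
      - (fderiv ℝ (fun u => christoffel G u x z) u y
        + christoffel G u y (christoffel G u x z)) := by
  have h (v w : E) : covDeriv G (fun _ => v) (fun _ => w) = fun u => christoffel G u v w := by
    ext u
    simp [covDeriv]
  simp [curvature, h, covDeriv]

theorem fderiv_apply_comm (hG : DifferentiableAt ℝ G u)
    (hsymm : ∀ᶠ u in 𝓝 u, ∀ v w, G u v w = G u w v) (x v w : E) :
    fderiv ℝ G u x v w = fderiv ℝ G u x w v := by
  have h (v w : E) : HasFDerivAt (fun u => G u v w)
      ((fderiv ℝ G u).flip v |>.flip w) u :=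
    (hG.hasFDerivAt.clm_apply (hasFDerivAt_const v u)).clm_apply (hasFDerivAt_const w u)
      |>.congr_fderiv (by ext; simp)
  have h2 := (h v w).unique
    ((h w v).congr_of_eventuallyEq (hsymm.mono fun u hu => hu v w))
  simpa using congrArg (fun L => L x) h2

theorem contDiffAt_inverse [CompleteSpace E] {n : WithTop ℕ∞} (hG : ContDiffAt ℝ n G u)
    (h : (G u).IsInvertible) : ContDiffAt ℝ n (fun u => (G u).inverse) u := by
  obtain ⟨e, he⟩ := h
  exact ContDiffAt.comp u (he ▸ contDiffAt_map_inverse e) hG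

theorem differentiableAt_christoffel [CompleteSpace E] (hG : ContDiffAt ℝ 2 G u)
    (h : (G u).IsInvertible) (v w : E) :
    DifferentiableAt ℝ (fun u => christoffel G u v w) u := by
  have h1 : DifferentiableAt ℝ (fderiv ℝ G) u :=
    (hG.fderiv_right (m := 1) (by norm_num)).differentiableAt (by norm_num)
  have h2 : DifferentiableAt ℝ (fun u => (G u).inverse) u :=
    (contDiffAt_inverse hG h).differentiableAt (by norm_num)
  have h3 : DifferentiableAt ℝ (fun u => ((fderiv ℝ G u).flip v).flip w) u := by
    let L : (E →L[ℝ] E →L[ℝ] ℝ) →L[ℝ] ℝ :=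
      (ContinuousLinearMap.apply ℝ ℝ w).comp (ContinuousLinearMap.apply ℝ (E →L[ℝ] ℝ) v)
    have : (fun u => ((fderiv ℝ G u).flip v).flip w) = fun u => L.comp (fderiv ℝ G u) := rfl
    rw [this]
    exact (differentiableAt_const L).clm_comp h1
  unfold christoffel
  fun_prop

/-- Differentiating the factor adds `2 df ⊗ G`; the 2 cancels the `½` of the Koszul formula, and the
exponential cancels against the inverse of the rescaled metric. -/
theorem christoffel_conformal (h : (G u).IsInvertible) (hG : DifferentiableAt ℝ G u)
    (hf : DifferentiableAt ℝ f u) (v w : E) :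
    christoffel (fun u => Real.exp (2 * f u) • G u) u v w = christoffel G u v w +
      (fderiv ℝ f u v • w + fderiv ℝ f u w • v - G u v w • (G u).inverse (fderiv ℝ f u)) := by
  have hd : fderiv ℝ (fun u => Real.exp (2 * f u) • G u) u =
      Real.exp (2 * f u) • (fderiv ℝ G u + ((2 : ℝ) • fderiv ℝ f u).smulRight (G u)) := by
    have := ((hf.hasFDerivAt.const_mul 2).exp.smul hG.hasFDerivAt).fderiv
    refine this.trans ?_
    ext x y z
    simp
    ring
  have he : Real.exp (2 * f u) ≠ 0 := (Real.exp_pos _).ne'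
  have hinv : (Real.exp (2 * f u) • G u).IsInvertible := by
    obtain ⟨e, he'⟩ := h
    refine ⟨e.trans (ContinuousLinearEquiv.smulLeft (Units.mk0 _ he)), ?_⟩
    rw [← he']
    ext
    simp
  apply hinv.injective
  ext z
  rw [apply_christoffel (G := fun u => Real.exp (2 * f u) • G u) hinv, hd]
  simp only [map_add, map_sub, map_smul, add_apply, sub_apply, smul_apply, smul_eq_mul,
    apply_christoffel h, h.self_apply_inverse, ContinuousLinearMap.smulRight_apply]
  ring

/-- The gradient of `f` with respect to the metric `G`. -/
def gradient (G : E → E →L[ℝ] E →L[ℝ] ℝ) (f : E → ℝ) (u : E) : E :=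
  (G u).inverse (fderiv ℝ f u)

theorem apply_gradient (h : (G u).IsInvertible) (z : E) :
    G u (gradient G f u) z = fderiv ℝ f u z := by
  simp [gradient, h.self_apply_inverse]

theorem differentiableAt_gradient [CompleteSpace E] (hG : ContDiffAt ℝ 2 G u)
    (hf : ContDiffAt ℝ 2 f u) (h : (G u).IsInvertible) :
    DifferentiableAt ℝ (gradient G f) u := by
  have h1 : DifferentiableAt ℝ (fderiv ℝ f) u :=
    (hf.fderiv_right (m := 1) (by norm_num)).differentiableAt (by norm_num)
  exact ((contDiffAt_inverse hG h).differentiableAt (by norm_num)).clm_apply h1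

/-- The endomorphism `x ↦ ∇_x N - df(x) N + ½ |N|² x`, where `N` is the gradient of `f`. -/
def schouten (G : E → E →L[ℝ] E →L[ℝ] ℝ) (f : E → ℝ) (u : E) : E →ₗ[ℝ] E where
  toFun x := fderiv ℝ (gradient G f) u x + christoffel G u (gradient G f u) x
    - fderiv ℝ f u x • gradient G f u + (2⁻¹ * fderiv ℝ f u (gradient G f u)) • x
  map_add' x y := by
    simp only [map_add, christoffel_add]
    module
  map_smul' c x := by
    simp only [map_smul, christoffel_smul, smul_eq_mul, RingHom.id_apply]
    module

/-- This is `Hess f - df ⊗ df + ½ |N|² G`, a form in which the self-adjointness of `schouten` is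
visible. -/
theorem apply_schouten [CompleteSpace E] (hG : ContDiffAt ℝ 2 G u) (hf : ContDiffAt ℝ 2 f u)
    (hinv : ∀ᶠ u in 𝓝 u, (G u).IsInvertible)
    (hsymm : ∀ᶠ u in 𝓝 u, ∀ v w, G u v w = G u w v) (x z : E) :
    G u (schouten G f u x) z = fderiv ℝ (fderiv ℝ f) u x z - fderiv ℝ f u (christoffel G u x z)
      - fderiv ℝ f u x * fderiv ℝ f u z + 2⁻¹ * fderiv ℝ f u (gradient G f u) * G u x z := by
  have h := hinv.self_of_nhds
  have hGd : DifferentiableAt ℝ G u := hG.differentiableAt (by norm_num)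
  have hf1 : DifferentiableAt ℝ (fderiv ℝ f) u :=
    (hf.fderiv_right (m := 1) (by norm_num)).differentiableAt (by norm_num)
  have hN : DifferentiableAt ℝ (gradient G f) u :=
    differentiableAt_gradient hG hf h
  -- Differentiate the identity `G(N, z) = df(z)`, valid near `u`.
  have key : fderiv ℝ G u x (gradient G f u) z + G u (fderiv ℝ (gradient G f) u x) z =
      fderiv ℝ (fderiv ℝ f) u x z := by
    have h1 := (hGd.hasFDerivAt.clm_apply hN.hasFDerivAt).clm_apply (hasFDerivAt_const z u)
    have h2 := hf1.hasFDerivAt.clm_apply (hasFDerivAt_const z u)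
    have h3 : (fun u => G u (gradient G f u) z) =ᶠ[𝓝 u] fun u => fderiv ℝ f u z :=
      hinv.mono fun u hu => apply_gradient hu z
    have h4 := congrArg (fun L => L x) (h1.unique (h2.congr_of_eventuallyEq h3))
    simpa [add_comm] using h4
  have hG' := fderiv_apply_comm hGd hsymm
  have hG0 := hsymm.self_of_nhds
  have hΓ : fderiv ℝ f u (christoffel G u x z) = G u (christoffel G u x z) (gradient G f u) := by
    rw [hG0, apply_gradient h]
  simp only [schouten, LinearMap.coe_mk, AddHom.coe_mk, map_add, map_sub, map_smul, add_apply,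
    sub_apply, smul_apply, smul_eq_mul, apply_christoffel h, apply_gradient h, hΓ, ← key,
    hG' x z, hG' z _ x]
  ring

theorem curvature_conformal [CompleteSpace E] (hG : ContDiffAt ℝ 2 G u) (hf : ContDiffAt ℝ 2 f u)
    (hinv : ∀ᶠ u in 𝓝 u, (G u).IsInvertible)
    (hsymm : ∀ᶠ u in 𝓝 u, ∀ v w, G u v w = G u w v) (x y z : E) :
    curvature (fun u => Real.exp (2 * f u) • G u) u x y z =
      curvature G u x y z + kulkarniNomizu (G u) (schouten G f u) x y z := by
  have h := hinv.self_of_nhds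
  have hGd : DifferentiableAt ℝ G u := hG.differentiableAt (by norm_num)
  have hfd : DifferentiableAt ℝ f u := hf.differentiableAt (by norm_num)
  have hf1 : DifferentiableAt ℝ (fderiv ℝ f) u :=
    (hf.fderiv_right (m := 1) (by norm_num)).differentiableAt (by norm_num)
  have hN : DifferentiableAt ℝ (gradient G f) u := differentiableAt_gradient hG hf h
  have hG' := fderiv_apply_comm hGd hsymm
  have hG0 := hsymm.self_of_nhds
  have hd (x y z : E) :
      fderiv ℝ (fun u => christoffel (fun u => Real.exp (2 * f u) • G u) u y z) u x =
        fderiv ℝ (fun u => christoffel G u y z) u x +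
        (fderiv ℝ (fderiv ℝ f) u x y • z + fderiv ℝ (fderiv ℝ f) u x z • y
          - fderiv ℝ G u x y z • gradient G f u
          - G u y z • fderiv ℝ (gradient G f) u x) := by
    -- The conformal formula is about to be differentiated, so it is needed on a neighbourhood.
    have hev : (fun u => christoffel (fun u => Real.exp (2 * f u) • G u) u y z) =ᶠ[𝓝 u]
        fun u => christoffel G u y z + (fderiv ℝ f u y • z + fderiv ℝ f u z • y
          - G u y z • gradient G f u) := by
      filter_upwards [hinv, hG.eventually (by norm_num), hf.eventually (by norm_num)]
        with u h1 h2 h3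
      exact christoffel_conformal h1 (h2.differentiableAt (by norm_num))
        (h3.differentiableAt (by norm_num)) y z
    have h1 (y : E) := hf1.hasFDerivAt.clm_apply (hasFDerivAt_const y u)
    have h2 := (hGd.hasFDerivAt.clm_apply (hasFDerivAt_const y u)).clm_apply
      (hasFDerivAt_const z u)
    have h3 := (differentiableAt_christoffel hG h y z).hasFDerivAt.add
      ((((h1 y).smul_const z).add ((h1 z).smul_const y)).sub (h2.smul hN.hasFDerivAt))
    rw [(h3.congr_of_eventuallyEq hev).fderiv]
    simp
    module
  -- Metric compatibility, antisymmetrized in `x, y`. It cancels the derivatives of `G` left in the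
  -- coefficient of the gradient.
  have hΓ : G u x (christoffel G u y z) - G u y (christoffel G u x z) =
      fderiv ℝ G u y x z - fderiv ℝ G u x y z := by
    rw [hG0 x, hG0 y, apply_christoffel h, apply_christoffel h, hG' y z, hG' x z, hG' z y]
    ring
  have hN' (v : E) : G u v (gradient G f u) = fderiv ℝ f u v := by
    rw [hG0, apply_gradient h]
  have hc := christoffel_comm (u := u) hG'
  rw [curvature_eq, curvature_eq, hd, hd]
  simp only [christoffel_conformal h hGd hfd, kulkarniNomizu, ← gradient.eq_1,
    apply_schouten hG hf hinv hsymm]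
  simp only [schouten, LinearMap.coe_mk, AddHom.coe_mk, christoffel_add, christoffel_sub,
    christoffel_smul, map_add, map_sub, map_smul, smul_eq_mul, hN',
    hc y x, hc (gradient G f u) _, hG0 y x]
  rw [(hf.isSymmSndFDerivAt (by simp)).eq y x]
  linear_combination (norm := module) (-hΓ) • gradient G f u

end LocalMetric

/-! ### From the chart to the manifold -/

section

open Filter Topology Bundle

variable {E : Type*} [NormedAddCommGroup E] [NormedSpace ℝ E]
  {M : Type*} [TopologicalSpace M] [ChartedSpace E M] [IsManifold 𝓘(ℝ, E) ∞ M]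

section

variable
  (g : Bundle.ContMDiffRiemannianMetric 𝓘(ℝ, E) ∞ E (fun P : M => TangentSpace 𝓘(ℝ, E) P))
  (P : M) {u : E}

theorem metricInChart_apply (u v w : E) : metricInChart g P u v w =
    g.inner ((extChartAt 𝓘(ℝ, E) P).symm u)
      (mfderiv 𝓘(ℝ, E) 𝓘(ℝ, E) (extChartAt 𝓘(ℝ, E) P).symm u v)
      (mfderiv 𝓘(ℝ, E) 𝓘(ℝ, E) (extChartAt 𝓘(ℝ, E) P).symm u w) := rfl

theorem metricInChart_symm (u v w : E) : metricInChart g P u v w = metricInChart g P u w v := by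
  rw [metricInChart_apply, metricInChart_apply, g.symm]

theorem isInvertible_mfderiv_extChartAt_symm (hu : u ∈ (extChartAt 𝓘(ℝ, E) P).target) :
    (mfderiv 𝓘(ℝ, E) 𝓘(ℝ, E) (extChartAt 𝓘(ℝ, E) P).symm u).IsInvertible := by
  have : IsManifold 𝓘(ℝ, E) 1 M := .of_le (n := ∞) (by norm_num)
  have := isInvertible_mfderivWithin_extChartAt_symm hu
  simpa using this

theorem metricInChart_pos (hu : u ∈ (extChartAt 𝓘(ℝ, E) P).target) {v : E} (hv : v ≠ 0) :
    0 < metricInChart g P u v v := by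
  rw [metricInChart_apply]
  refine g.pos _ _ fun h => hv ?_
  exact (isInvertible_mfderiv_extChartAt_symm P hu).injective (h.trans (map_zero _).symm)

theorem isInvertible_metricInChart [FiniteDimensional ℝ E]
    (hu : u ∈ (extChartAt 𝓘(ℝ, E) P).target) : (metricInChart g P u).IsInvertible := by
  have hinj : LinearMap.ker (metricInChart g P u).toLinearMap = ⊥ := by
    refine LinearMap.ker_eq_bot'.2 fun v hv => ?_
    by_contra h
    have := metricInChart_pos g P hu h
    have h2 : metricInChart g P u v = 0 := hv
    simp [h2] at this
  have hdim : Module.finrank ℝ E = Module.finrank ℝ (E →L[ℝ] ℝ) := by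
    rw [← Subspace.dual_finrank_eq]
    exact LinearMap.toContinuousLinearMap.finrank_eq
  refine ⟨(LinearEquiv.ofInjectiveOfFinrankEq (metricInChart g P u).toLinearMap
    (LinearMap.ker_eq_bot.1 hinj) hdim).toContinuousLinearEquiv, ?_⟩
  ext
  rfl

/-- The coefficients are `g` evaluated on coordinate vector fields, which are the constant sections
of the tangent trivialization and hence smooth. -/
theorem contDiffOn_metricInChart [FiniteDimensional ℝ E] :
    ContDiffOn ℝ ∞ (metricInChart g P) (extChartAt 𝓘(ℝ, E) P).target := by
  have : IsManifold 𝓘(ℝ, E) 1 M := .of_le (n := ∞) (by norm_num)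
  have : IsManifold 𝓘(ℝ, E) (∞ + 1) M := inferInstanceAs (IsManifold 𝓘(ℝ, E) ∞ M)
  refine contDiffOn_clm_apply.2 fun v => contDiffOn_clm_apply.2 fun w => ?_
  rw [← contMDiffOn_iff_contDiffOn]
  have hs (v : E) : ContMDiffOn 𝓘(ℝ, E) (𝓘(ℝ, E).prod 𝓘(ℝ, E)) ∞
      (fun Q : M => TotalSpace.mk' E (E := fun Q : M => TangentSpace 𝓘(ℝ, E) Q) Q
        ((trivializationAt E (TangentSpace 𝓘(ℝ, E)) P).symmL ℝ Q v))
      (extChartAt 𝓘(ℝ, E) P).source := by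
    intro Q hQ
    have h1 := (trivializationAt E (TangentSpace 𝓘(ℝ, E)) P).contMDiffAt_symmL
      (IB := 𝓘(ℝ, E)) (n := ∞) (x := Q) (by simpa using hQ)
    have h2 : ContMDiffAt 𝓘(ℝ, E) (𝓘(ℝ, E).prod 𝓘(ℝ, E)) ∞
        (fun Q : M => TotalSpace.mk' E (E := Bundle.Trivial M E) Q v) Q :=
      Bundle.contMDiffAt_section Q |>.2 (by simpa using contMDiffAt_const)
    exact (h1.clm_bundle_apply (E₁ := Bundle.Trivial M E) (F₁ := E) (b := fun Q => Q)
      h2).contMDiffWithinAt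
  have hg : ContMDiffOn 𝓘(ℝ, E) 𝓘(ℝ, ℝ) ∞ (fun Q : M => g.inner Q
      ((trivializationAt E (TangentSpace 𝓘(ℝ, E)) P).symmL ℝ Q v)
      ((trivializationAt E (TangentSpace 𝓘(ℝ, E)) P).symmL ℝ Q w))
      (extChartAt 𝓘(ℝ, E) P).source := fun Q hQ => by
    have h := (g.contMDiff Q).contMDiffWithinAt.clm_bundle_apply₂ (F₃ := ℝ)
      (E₃ := Bundle.Trivial M ℝ) (hs v Q hQ) (hs w Q hQ)
    simpa using (contMDiffWithinAt_totalSpace.1 h).2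
  refine (hg.comp (contMDiffOn_extChartAt_symm P) fun u hu =>
    (extChartAt 𝓘(ℝ, E) P).map_target hu).congr fun u hu => ?_
  have hQ := (extChartAt 𝓘(ℝ, E) P).map_target hu
  rw [metricInChart_apply, Function.comp_apply,
    TangentBundle.symmL_trivializationAt (by simpa using hQ), (extChartAt 𝓘(ℝ, E) P).right_inv hu,
    modelWithCornersSelf_coe, Set.range_id, mfderivWithin_univ]
  rfl

theorem metricInChart_mfderiv {Q : M} (hQ : Q ∈ (extChartAt 𝓘(ℝ, E) P).source)
    (v w : TangentSpace 𝓘(ℝ, E) Q) :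
    metricInChart g P (extChartAt 𝓘(ℝ, E) P Q)
      (mfderiv 𝓘(ℝ, E) 𝓘(ℝ, E) (extChartAt 𝓘(ℝ, E) P) Q v)
      (mfderiv 𝓘(ℝ, E) 𝓘(ℝ, E) (extChartAt 𝓘(ℝ, E) P) Q w) = g.inner Q v w := by
  have : IsManifold 𝓘(ℝ, E) 1 M := .of_le (n := ∞) (by norm_num)
  obtain ⟨u, hu, rfl⟩ : ∃ u ∈ (extChartAt 𝓘(ℝ, E) P).target,
      (extChartAt 𝓘(ℝ, E) P).symm u = Q :=
    ⟨_, (extChartAt 𝓘(ℝ, E) P).map_source hQ, (extChartAt 𝓘(ℝ, E) P).left_inv hQ⟩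
  have h := mfderivWithin_extChartAt_symm_comp_mfderiv_extChartAt hu
  rw [modelWithCornersSelf_coe, Set.range_id, mfderivWithin_univ] at h
  rw [(extChartAt 𝓘(ℝ, E) P).right_inv hu]
  exact congrArg₂ (fun a b => g.inner _ a b) (congrArg (fun L => L v) h)
    (congrArg (fun L => L w) h)

/-- The chart depends only on `P`, so one `D` serves every metric and two curvatures can be compared
in the same coordinates. -/
theorem exists_equiv_curvatureOperator : ∃ D : TangentSpace 𝓘(ℝ, E) P ≃L[ℝ] E,
    (∀ (g : Bundle.ContMDiffRiemannianMetric 𝓘(ℝ, E) ∞ E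
        (fun P : M => TangentSpace 𝓘(ℝ, E) P)) (v w : TangentSpace 𝓘(ℝ, E) P),
      metricInChart g P (extChartAt 𝓘(ℝ, E) P P) (D v) (D w) = g.inner P v w) ∧
    ∀ (g : Bundle.ContMDiffRiemannianMetric 𝓘(ℝ, E) ∞ E
        (fun P : M => TangentSpace 𝓘(ℝ, E) P)) (x y z : TangentSpace 𝓘(ℝ, E) P),
      curvatureOperator g P x y z = D.symm
        (LocalMetric.curvature (metricInChart g P) (extChartAt 𝓘(ℝ, E) P P) (D x) (D y) (D z)) := by
  have : IsManifold 𝓘(ℝ, E) 1 M := .of_le (n := ∞) (by norm_num)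
  obtain ⟨D, hD⟩ := isInvertible_mfderiv_extChartAt (I := 𝓘(ℝ, E)) (mem_extChartAt_source P)
  refine ⟨D, fun g v w => ?_, fun g x y z => ?_⟩
  · rw [← metricInChart_mfderiv g P (mem_extChartAt_source P) v w, ← hD]
    rfl
  · simp only [curvatureOperator, ← hD]
    exact congrFun (congrArg DFunLike.coe (ContinuousLinearMap.inverse_equiv D)) _

end

section

variable (α : M → ℝ)
  (hα : ContMDiff 𝓘(ℝ, E) 𝓘(ℝ, ℝ) ∞ α)

theorem metricInChart_conformal
    (g : Bundle.ContMDiffRiemannianMetric 𝓘(ℝ, E) ∞ E (fun P : M => TangentSpace 𝓘(ℝ, E) P))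
    (P : M) : metricInChart (conformalMetric g α hα) P = fun u =>
      Real.exp (2 * (2⁻¹ * α ((extChartAt 𝓘(ℝ, E) P).symm u))) • metricInChart g P u := by
  ext u v w
  rw [mul_inv_cancel_left₀ two_ne_zero]
  rfl

/-- Here `s` is `schouten` for `f = α/2`, conjugated by the chart differential; the algebra needs
only its self-adjointness. -/
theorem exists_curvatureOperator_conformal [FiniteDimensional ℝ E]
    (g : Bundle.ContMDiffRiemannianMetric 𝓘(ℝ, E) ∞ E (fun P : M => TangentSpace 𝓘(ℝ, E) P))
    (P : M) : ∃ s : TangentSpace 𝓘(ℝ, E) P →ₗ[ℝ] TangentSpace 𝓘(ℝ, E) P,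
      (∀ v w, g.inner P (s v) w = g.inner P (s w) v) ∧
      ∀ x y z, curvatureOperator (conformalMetric g α hα) P x y z =
        curvatureOperator g P x y z + kulkarniNomizu (g.inner P) s x y z := by
  set φ := extChartAt 𝓘(ℝ, E) P with hφ
  set G := metricInChart g P with hGdef
  set f : E → ℝ := fun u => 2⁻¹ * α (φ.symm u) with hf
  have ht : φ.target ∈ 𝓝 (φ P) := extChartAt_target_mem_nhds P
  have hG : ContDiffAt ℝ 2 G (φ P) :=
    ((contDiffOn_metricInChart g P).contDiffAt ht).of_le (WithTop.coe_le_coe.2 (le_top : (2 : ℕ∞) ≤ ⊤))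
  have hfC : ContDiffAt ℝ 2 f (φ P) := by
    have h : ContMDiffOn 𝓘(ℝ, E) 𝓘(ℝ, ℝ) ∞ (α ∘ φ.symm) φ.target :=
      hα.comp_contMDiffOn (contMDiffOn_extChartAt_symm P)
    exact contDiffAt_const.mul
      (((contMDiffOn_iff_contDiffOn.1 h).contDiffAt ht).of_le (WithTop.coe_le_coe.2 (le_top : (2 : ℕ∞) ≤ ⊤)))
  have hinv : ∀ᶠ u in 𝓝 (φ P), (G u).IsInvertible :=
    eventually_of_mem ht fun u hu => isInvertible_metricInChart g P hu
  have hsymm : ∀ᶠ u in 𝓝 (φ P), ∀ v w, G u v w = G u w v :=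
    .of_forall fun u v w => metricInChart_symm g P u v w
  have : CompleteSpace E := FiniteDimensional.complete ℝ E
  obtain ⟨D, hD, hcurvD⟩ := exists_equiv_curvatureOperator (E := E) P
  replace hD : ∀ v w, G (φ P) (D v) (D w) = g.inner P v w := hD g
  have hschouten := LocalMetric.apply_schouten hG hfC hinv hsymm
  have hcurv := LocalMetric.curvature_conformal hG hfC hinv hsymm
  have hself (v w : E) : G (φ P) (LocalMetric.schouten G f (φ P) v) w =
      G (φ P) (LocalMetric.schouten G f (φ P) w) v := by
    rw [hschouten, hschouten, (hfC.isSymmSndFDerivAt (by simp)).eq v w,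
      LocalMetric.christoffel_comm (LocalMetric.fderiv_apply_comm
        (hG.differentiableAt (by norm_num)) hsymm) v w, hsymm.self_of_nhds v w]
    ring
  refine ⟨D.symm.toLinearMap ∘ₗ LocalMetric.schouten G f (φ P) ∘ₗ D.toLinearMap,
    fun v w => ?_, fun x y z => ?_⟩
  · simpa [← hD] using hself (D v) (D w)
  · rw [hcurvD, hcurvD, metricInChart_conformal, hcurv, map_add]
    simp [kulkarniNomizu, ← hD, hGdef, hφ]

variable (C : AlmostHermitian E M) {P : M}

namespace AlmostHermitian

theorem isComplexLine_span {x : TangentSpace 𝓘(ℝ, E) P} (hx : C.g.inner P x x = 1) :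
    C.IsComplexLine P (Submodule.span ℝ {x, C.J P x}) := by
  have hJ0 : C.g.inner P x (C.J P x) = 0 := by
    have h := C.unitary P x (C.J P x)
    rw [C.J_sq, map_neg, C.g.symm] at h
    linarith
  refine ⟨?_, ?_⟩
  · have hli : LinearIndependent ℝ ![x, C.J P x] := by
      rw [LinearIndependent.pair_iff]
      intro a b h
      have h1 := congrArg (C.g.inner P x) h
      have h2 := congrArg (C.g.inner P (C.J P x)) h
      simp only [map_add, map_smul, smul_eq_mul, hx, hJ0, C.unitary, C.g.symm P (C.J P x) x,
        map_zero] at h1 h2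
      exact ⟨by linarith, by linarith⟩
    have h := finrank_span_eq_card hli
    rwa [Matrix.range_cons_cons_empty, Fintype.card_fin] at h
  · rw [Submodule.map_span, Set.image_pair]
    simp only [ContinuousLinearMap.coe_coe, C.J_sq]
    refine le_antisymm (Submodule.span_le.2 ?_) (Submodule.span_le.2 ?_)
    · rintro _ (rfl | rfl)
      · exact Submodule.subset_span (by simp)
      · exact neg_mem (Submodule.subset_span (by simp))
    · rintro _ (h | h)
      · rw [h, ← neg_neg x]
        exact neg_mem (Submodule.subset_span (by simp))
      · exact Submodule.subset_span (by rw [h]; simp)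

end AlmostHermitian

end

end

end

/-- If the complex Jacobi operators of `(M, g, J)` and `(M, e^α g, J)`, both formed with the same
`g`-unit vectors, agree on all complex lines, then the curvature operators agree. -/
theorem mainTheorem8 {E : Type*} [NormedAddCommGroup E] [NormedSpace ℝ E] [FiniteDimensional ℝ E]
    {M : Type*} [TopologicalSpace M] [ChartedSpace E M] [IsManifold 𝓘(ℝ, E) ∞ M]
    (C : AlmostHermitian E M) (α : M → ℝ) (hα : ContMDiff 𝓘(ℝ, E) 𝓘(ℝ, ℝ) ∞ α)
    (hJ : ∀ (P : M) (L : Submodule ℝ (TangentSpace 𝓘(ℝ, E) P)), C.IsComplexLine P L →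
      ∀ x ∈ L, C.g.inner P x x = 1 →
        ∀ y : TangentSpace 𝓘(ℝ, E) P,
          C.complexJacobi P x y = (C.conformal α hα).complexJacobi P x y) :
    ∀ (P : M) (x y z : TangentSpace 𝓘(ℝ, E) P),
      curvatureOperator C.g P x y z = curvatureOperator (C.conformal α hα).g P x y z := by
  intro P x y z
  obtain ⟨s, hs, hcurv⟩ := exists_curvatureOperator_conformal α hα C.g P
  have hcurv' : ∀ x y z, curvatureOperator (C.conformal α hα).g P x y z =
      curvatureOperator C.g P x y z + kulkarniNomizu (C.g.inner P) s x y z := hcurv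
  rw [hcurv', kulkarniNomizu_eq_zero (C.g.symm P) (C.g.pos P) hs (C.J_sq P) (C.unitary P) _ x y z,
    add_zero]
  intro x hx y
  -- The vector `x` is not renormalized for the second metric, so no factor `e^α` enters and the
  -- `g`-terms cancel.
  have h := hJ P _ (C.isComplexLine_span hx) x (Submodule.subset_span (by simp)) hx y
  have hJ' : (C.conformal α hα).J P x = C.J P x := rfl
  simp only [AlmostHermitian.complexJacobi, AlmostHermitian.jacobi, hcurv', hJ'] at h
  rw [add_add_add_comm] at h
  exact left_eq_add.1 h
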